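/- Let $\mathcal H$ be a complex Hilbert space. A closed real subspace $V\subseteq\mathcal H$ is called standard if $V\cap iV=\{0\}$ and $V+iV$ is dense in $\mathcal H$; $\mathrm{Stand}(\mathcal H)$ denotes the set of standard subspaces. For $V\in\mathrm{Stand}(\mathcal H)$ let $S_V$ be the closed antilinear operator with domain $V+iV$ given by $S_V(v+iw)=v-iw$ for $v,w\in V$, and let $S_V=J_V\Delta_V^{1/2}$ be its polar decomposition, so that $\Delta_V^{1/2}$ is positive selfadjoint and $J_V$ is antiunitary (in fact an antiunitary involution). For $V_1,V_2\in\mathrm{Stand}(\mathcal H)$ put $V_1\bullet V_2:=J_{V_1}J_{V_2}V_2\in\mathrm{Stand}(\mathcal H)$. A geodesic in $\mathrm{Stand}(\mathcal H)$ is a map $\gamma:\mathbb R\to\mathrm{Stand}(\mathcal H)$ with $\gamma(2s-t)=\gamma(s)\bullet\gamma(t)$ for all $s,t\in\mathbb R$. Let $\gamma:\mathbb R\to\mathrm{Stand}(\mathcal H)$ be a geodesic with $\gamma(0)=V$ such that $t\mapsto J_{\gamma(t)}$ is strongly continuous, i.e. $t\mapsto J_{\gamma(t)}x$ is continuous for every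 $x\in\mathcal H$. Then there exists a unique strongly continuous unitary one-parameter group $(U_t)_{t\in\mathbb R}$ on $\mathcal H$ such that $$J_VU_tJ_V=U_{-t}\quad\text{and}\quad \gamma(t)=U_{t/2}V\qquad\text{for all }t\in\mathbb R.$$ Moreover, for all $t\in\mathbb R$, $$J_{\gamma(t)}=U_{t/2}J_VU_{t/2}^{-1}=U_tJ_V,\qquad U_t=J_{\gamma(t)}J_V,$$ and these relations determine $U$: a family $(W_t)_{t\in\mathbb R}$ of unitary operators with $J_{\gamma(t)}=W_tJ_V$ for all $t$ equals $(U_t)_{t\in\mathbb R}$, and so does any strongly continuous unitary one-parameter group $(W_t)_{t\in\mathbb R}$ with $J_VW_tJ_V=W_{-t}$ and $J_{\gamma(t)}=W_{t/2}J_VW_{t/2}^{-1}$ for all $t$. -/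

import Mathlib

open scoped ComplexConjugate

namespace StandardSubspace

section

variable {H : Type*} [NormedAddCommGroup H] [InnerProductSpace ℂ H]

/-- A unitary operator, regarded as a real-linear homeomorphism. -/
noncomputable def unitaryToReal (U : H ≃ₗᵢ[ℂ] H) : H ≃L[ℝ] H :=
  U.toContinuousLinearEquiv.restrictScalars ℝ

theorem mapEquiv_mulI (U : H ≃ₗᵢ[ℂ] H) (S : ClosedSubmodule ℝ H) :
    (S.mapEquiv (unitaryToReal U)).mulI = S.mulI.mapEquiv (unitaryToReal U) := by
  ext x
  have h : ∀ y : H, (unitaryToReal U).symm y = U.symm y := fun _ => rfl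
  simp only [Submodule.carrier_eq_coe, ClosedSubmodule.coe_toSubmodule, SetLike.mem_coe,
    ClosedSubmodule.mem_mapEquiv_iff, scalarSMulCLE_symm_apply, h, Units.smul_def, map_smul]

/-- The image `U V = {U v | v ∈ V}` of a standard subspace `V` under a unitary operator `U`. -/
noncomputable def map (U : H ≃ₗᵢ[ℂ] H) (V : StandardSubspace H) : StandardSubspace H where
  toClosedSubmodule := V.toClosedSubmodule.mapEquiv (unitaryToReal U)
  IsSeparating := by
    rw [mapEquiv_mulI, ← ClosedSubmodule.mapEquiv_inf_eq, V.IsSeparating]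
    simp
  IsCyclic := by
    rw [mapEquiv_mulI, ← ClosedSubmodule.mapEquiv_sup_eq, V.IsCyclic]
    simp

theorem mem_map_iff (U : H ≃ₗᵢ[ℂ] H) (V : StandardSubspace H) (x : H) :
    x ∈ (V.map U).toClosedSubmodule ↔ ∃ v ∈ V.toClosedSubmodule, U v = x := by
  change x ∈ V.toClosedSubmodule.mapEquiv (unitaryToReal U) ↔ _
  rw [ClosedSubmodule.mem_mapEquiv_iff]
  exact ⟨fun h => ⟨_, h, U.apply_symm_apply x⟩, fun ⟨v, hv, h⟩ => by
    subst h
    exact (U.symm_apply_apply v).symm ▸ hv⟩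

/-- The graph of the Tomita operator `S : V + iV → V + iV`, `S (v + i w) = v - i w`. -/
def tomitaGraph (V : StandardSubspace H) : Set (H × H) :=
  {p | ∃ v ∈ V.toClosedSubmodule, ∃ w ∈ V.toClosedSubmodule,
    p = (v + Complex.I • w, v - Complex.I • w)}

end

section

variable {H : Type*} [NormedAddCommGroup H] [InnerProductSpace ℂ H] [CompleteSpace H]

/-- `S = J A` is the polar decomposition of the Tomita operator `S` of `V`: the operator `A` is a
positive selfadjoint (in general unbounded) complex linear operator and `J` is antiunitary.
The equivalence of graphs contains the equality of domains `dom A = V + iV`.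
In the usual notation `A = |S| = Δ_V ^ (1/2)` and `J = J_V`. -/
structure IsPolarDecomposition (V : StandardSubspace H) (J : H ≃ₗᵢ⋆[ℂ] H) (A : H →ₗ.[ℂ] H) :
    Prop where
  isSelfAdjoint : IsSelfAdjoint A
  nonneg : ∀ x : A.domain, 0 ≤ (inner ℂ (x : H) (A x)).re
  graph_iff : ∀ x y : H, (x, y) ∈ A.graph ↔ (x, J y) ∈ V.tomitaGraph

theorem nonempty_antiunitary : Nonempty (H ≃ₗᵢ⋆[ℂ] H) := by
  obtain ⟨w, b, -⟩ := exists_hilbertBasis ℂ H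
  exact ⟨(b.repr.trans (starₗᵢ ℂ)).trans b.repr.symm⟩

/-- The modular conjugation `J_V`: the antiunitary factor in the polar decomposition of the Tomita
operator of `V`. (The polar decomposition of a standard subspace exists and is unique, so the
choice made here is the selection of the unique such `J`.) -/
noncomputable def modularConj (V : StandardSubspace H) : H ≃ₗᵢ⋆[ℂ] H :=
  @Classical.epsilon _ nonempty_antiunitary
    (fun J => ∃ A : H →ₗ.[ℂ] H, V.IsPolarDecomposition J A)

/-- The reflection `V • W = s_V(W) = J_V J_W W` of the standard subspace `W` at `V`. -/
noncomputable def reflect (V W : StandardSubspace H) : StandardSubspace H :=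
  W.map (W.modularConj.trans V.modularConj)

/-- A geodesic in the reflection space of standard subspaces: a map `γ` from the reflection space
`ℝ`, with `s • t = s - t + s = 2 s - t`, that satisfies `γ (s • t) = γ s • γ t`. -/
def IsGeodesic (γ : ℝ → StandardSubspace H) : Prop :=
  ∀ s t : ℝ, γ (2 * s - t) = (γ s).reflect (γ t)

end

end StandardSubspace

/-- A strongly continuous unitary one-parameter group on `H`. -/
structure IsUnitaryOneParameterGroup {H : Type*} [NormedAddCommGroup H] [InnerProductSpace ℂ H]
    (U : ℝ → (H ≃ₗᵢ[ℂ] H)) : Prop where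
  map_add : ∀ s t : ℝ, U (s + t) = U s * U t
  continuous : ∀ x : H, Continuous fun t => U t x

/-!
The modular conjugation of a standard subspace `V` is the sign of a bounded operator (Rieffel and
van Daele). Let `P` and `Q = -i P i` be the real-orthogonal projections onto `V` and `i V`. Then
`P - Q` is antilinear, symmetric and injective, `P + Q` is complex linear, positive and injective,
and the Tomita operator `S` satisfies `S (P + Q) = P - Q`. Let `P - Q = J T` with `J` antiunitary
and `T = ((P - Q) ^ 2) ^ (1/2)`.

* `J S` is positive and self-adjoint (`IsModularPair.exists_isPolarDecomposition`). As `T` commutes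
  with `P`, `Q` and `P - Q`, the operator `J` is an involution and maps `V` onto its symplectic
  complement, whose Tomita operator is `S*`; hence `J S` is self-adjoint. Positivity amounts to
  `P J P ≥ 0`, which follows from `T (P J P) = P (P - Q) P ≥ 0`.
* Conversely, if `S = J A` is a polar decomposition, then `A (P + Q) = J⁻¹ (P - Q)` is positive
  (`IsPolarDecomposition.exists_isModularPair`), because `P + Q = 2 (1 + A ^ 2)⁻¹` commutes with
  `A`. So `J` is the antiunitary factor of `P - Q`, and uniqueness of bounded square roots makes it
  unique.

Consequently `J_V` is an involution, `J_{U V} = U J_V U⁻¹` for unitary `U`, and therefore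
`J_{V • W} = J_V J_W J_V`. For a geodesic `γ` with `J_t = J_{γ(t)}` this reads
`J_{2 s - t} = J_s J_t J_s`, so that `U_t = J_t J_0` satisfies `U_{2 s - t} = U_s U_t⁻¹ U_s` and
`U_0 = 1`. This gives `U_{n s} = U_s ^ n` for integers `n`, hence additivity on `ℚ`, hence on `ℝ` by
strong continuity. The relation `γ(2 s) = γ(s) • γ(0)` is `γ(2 s) = U_s V`.
-/

/-! ### Positive operators and their square roots -/

section Operators

variable {H : Type*} [NormedAddCommGroup H] [InnerProductSpace ℂ H]

theorem LinearIsometryEquiv.re_inner_map_map_of_antiunitary (J : H ≃ₗᵢ⋆[ℂ] H) (x y : H) :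
    (inner ℂ (J x) (J y)).re = (inner ℂ x y).re := by
  have h := @norm_add_sq ℂ H _ _ _ x y
  have h' := @norm_add_sq ℂ H _ _ _ (J x) (J y)
  rw [← map_add] at h'
  simp only [J.norm_map, RCLike.re_eq_complex_re] at h h'
  linarith

theorem LinearIsometryEquiv.inner_map_map_of_antiunitary (J : H ≃ₗᵢ⋆[ℂ] H) (x y : H) :
    inner ℂ (J x) (J y) = inner ℂ y x := by
  have h1 := J.re_inner_map_map_of_antiunitary x y
  have h2 := J.re_inner_map_map_of_antiunitary (Complex.I • x) y
  apply Complex.ext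
  · exact h1.trans (inner_re_symm (𝕜 := ℂ) x y)
  · rw [← inner_conj_symm y x]
    simp [-inner_conj_symm, inner_smul_left, LinearIsometryEquiv.map_smulₛₗ] at h2
    simp [-inner_conj_symm, ← h2]

theorem LinearIsometryEquiv.inner_eq_inner_antiunitary (J : H ≃ₗᵢ⋆[ℂ] H) (x y : H) :
    inner ℂ x (J.symm y) = inner ℂ y (J x) := by
  rw [← J.inner_map_map_of_antiunitary, J.apply_symm_apply]

/-- A continuous real-linear map that commutes with `i`, as a complex-linear map. -/
noncomputable def ContinuousLinearMap.complexLinearOfReal (B : H →L[ℝ] H)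
    (hB : ∀ x, B (Complex.I • x) = Complex.I • B x) : H →L[ℂ] H where
  toFun := B
  map_add' := B.map_add
  map_smul' c x := by
    have h : ∀ y : H, c • y = c.re • y + c.im • (Complex.I • y) := fun y => by
      conv_lhs => rw [← Complex.re_add_im c, add_smul, mul_smul]
      rfl
    rw [RingHom.id_apply, h, h, map_add, map_smul, map_smul, hB]
  cont := B.continuous

/-- A continuous real-linear map that anticommutes with `i`, as an antilinear map. -/
noncomputable def ContinuousLinearMap.antilinearOfReal (B : H →L[ℝ] H)
    (hB : ∀ x, B (Complex.I • x) = -(Complex.I • B x)) : H →L⋆[ℂ] H where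
  toFun := B
  map_add' := B.map_add
  map_smul' c x := by
    have h : ∀ (c : ℂ) (y : H), c • y = c.re • y + c.im • (Complex.I • y) := fun c y => by
      conv_lhs => rw [← Complex.re_add_im c, add_smul, mul_smul]
      rfl
    rw [h c x, h _ (B x), map_add, map_smul, map_smul, hB]
    simp
  cont := B.continuous

theorem ContinuousLinearMap.nonneg_of_symmetric {T : H →L[ℂ] H}
    (hs : ∀ x y, inner ℂ (T x) y = inner ℂ x (T y)) (hp : ∀ x, 0 ≤ (inner ℂ x (T x)).re) :
    0 ≤ T := by
  rw [ContinuousLinearMap.nonneg_iff_isPositive, ContinuousLinearMap.isPositive_def]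
  refine ⟨hs, fun x => ?_⟩
  rw [ContinuousLinearMap.reApplyInnerSelf_apply, hs]
  exact hp x

theorem ContinuousLinearMap.inner_symm_of_nonneg {T : H →L[ℂ] H} (hT : 0 ≤ T) (x y : H) :
    inner ℂ (T x) y = inner ℂ x (T y) :=
  ((ContinuousLinearMap.nonneg_iff_isPositive T).1 hT).1 x y

theorem ContinuousLinearMap.re_inner_nonneg_of_nonneg {T : H →L[ℂ] H} (hT : 0 ≤ T) (x : H) :
    0 ≤ (inner ℂ x (T x)).re := by
  have h := (ContinuousLinearMap.isPositive_def.1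
    ((ContinuousLinearMap.nonneg_iff_isPositive T).1 hT)).2 x
  rw [ContinuousLinearMap.reApplyInnerSelf_apply, inner_symm_of_nonneg hT] at h
  exact h

variable [CompleteSpace H]

theorem Submodule.dense_of_forall_inner_eq_zero (K : Submodule ℂ H)
    (h : ∀ x, (∀ y ∈ K, inner ℂ y x = 0) → x = 0) : Dense (K : Set H) := by
  rw [Submodule.dense_iff_topologicalClosure_eq_top, Submodule.topologicalClosure_eq_top_iff,
    Submodule.eq_bot_iff]
  exact fun x hx => h x fun y hy => (Submodule.mem_orthogonal K x).1 hx y hy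

theorem ContinuousLinearMap.denseRange_of_symmetric {T : H →L[ℂ] H}
    (hs : ∀ x y, inner ℂ (T x) y = inner ℂ x (T y)) (h0 : ∀ x, T x = 0 → x = 0) :
    DenseRange T := by
  have := Submodule.dense_of_forall_inner_eq_zero (LinearMap.range (T : H →ₗ[ℂ] H))
    fun x hx => h0 x <| by
      rw [← inner_self_eq_zero (𝕜 := ℂ), ← hs]
      exact hx _ ⟨_, rfl⟩
  rwa [DenseRange, ← T.coe_coe, ← LinearMap.coe_range]

/-- The positive square root is a limit of *real* polynomials, so that it commutes with real-linear
maps and not only with complex-linear ones. -/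
theorem ContinuousLinearMap.map_sqrt_apply {N : H →L[ℂ] H} (hN : 0 ≤ N) (B : H →L[ℝ] H)
    (hB : ∀ x, B (N x) = N (B x)) (x : H) : B (CFC.sqrt N x) = CFC.sqrt N (B x) := by
  have hmem : CFC.sqrt N ∈ StarAlgebra.elemental ℝ N := by
    rw [CFC.sqrt_eq_cfc]
    exact (range_cfc_nnreal_subset N hN ⟨_, rfl⟩).1
  generalize CFC.sqrt N = M at hmem
  have hstar : star N = N := IsSelfAdjoint.of_nonneg hN
  revert x
  induction hmem using StarAlgebra.elemental.induction_on with
  | self => exact hB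
  | star_self => rw [hstar]; exact hB
  | algebraMap r =>
    intro x
    simp [Algebra.algebraMap_eq_smul_one]
  | add u _ v _ hu hv =>
    intro x
    simp [hu x, hv x]
  | mul u _ v _ hu hv =>
    intro x
    simp [hu, hv]
  | closure s _ hs v hv =>
    intro x
    have hc : IsClosed {u : H →L[ℂ] H | B (u x) = u (B x)} :=
      isClosed_eq (B.continuous.comp (ContinuousLinearMap.apply ℂ H x).continuous)
        (ContinuousLinearMap.apply ℂ H (B x)).continuous
    exact closure_minimal (fun u hu => hs u hu x) hc hv

theorem ContinuousLinearMap.sqrt_apply_sqrt_apply {N : H →L[ℂ] H} (hN : 0 ≤ N) (x : H) :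
    CFC.sqrt N (CFC.sqrt N x) = N x :=
  congrArg (fun M : H →L[ℂ] H => M x) (CFC.sqrt_mul_sqrt_self N hN)

/-- If `N` is positive and injective, `B` commutes with `N` and `N B` is positive, then `B` is
positive: conjugate `N B` with `N ^ (-1/2)`, which is densely defined. -/
theorem ContinuousLinearMap.re_inner_nonneg_of_commute {N : H →L[ℂ] H} (hN : 0 ≤ N)
    (h0 : ∀ x, N x = 0 → x = 0) (B : H →L[ℝ] H) (hB : ∀ x, B (N x) = N (B x))
    (hpos : ∀ x, 0 ≤ (inner ℂ (N x) (B x)).re) (x : H) : 0 ≤ (inner ℂ x (B x)).re := by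
  have hS : 0 ≤ CFC.sqrt N := CFC.sqrt_nonneg N
  have hd : DenseRange (CFC.sqrt N : H →L[ℂ] H) := denseRange_of_symmetric (inner_symm_of_nonneg hS)
    fun x hx => h0 x (by rw [← sqrt_apply_sqrt_apply hN, hx, map_zero])
  have hc : IsClosed {x : H | 0 ≤ (inner ℂ x (B x)).re} :=
    isClosed_le continuous_const (Complex.continuous_re.comp (by fun_prop))
  refine hd.induction_on x hc fun u => ?_
  rw [map_sqrt_apply hN B hB, ← inner_symm_of_nonneg hS, sqrt_apply_sqrt_apply hN]
  exact hpos u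

end Operators

/-! ### The two projections of a standard subspace -/

namespace StandardSubspace

open ClosedSubmodule

variable {H : Type*} [NormedAddCommGroup H] [InnerProductSpace ℂ H] [CompleteSpace H]

/-- The real-orthogonal projection `P` onto `V`. -/
noncomputable def proj (V : StandardSubspace H) : H →L[ℝ] H :=
  V.toClosedSubmodule.toSubmodule.starProjection

/-- The real-orthogonal projection `Q = -i P i` onto `i V`. -/
noncomputable def projI (V : StandardSubspace H) : H →L[ℝ] H :=
  -((scalarSMulCLE H Complex.UnitI : H →L[ℝ] H) ∘L V.proj ∘L
    (scalarSMulCLE H Complex.UnitI : H →L[ℝ] H))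

variable (V : StandardSubspace H)

theorem projI_apply (x : H) : V.projI x = -(Complex.I • V.proj (Complex.I • x)) := rfl

theorem proj_mem (x : H) : V.proj x ∈ V.toClosedSubmodule :=
  Submodule.starProjection_apply_mem _ x

theorem proj_of_mem {v : H} (hv : v ∈ V.toClosedSubmodule) : V.proj v = v :=
  Submodule.starProjection_eq_self_iff.2 hv

theorem proj_proj (x : H) : V.proj (V.proj x) = V.proj x := V.proj_of_mem (V.proj_mem x)

theorem re_inner_proj (x y : H) : (inner ℂ (V.proj x) y).re = (inner ℂ x (V.proj y)).re :=
  Submodule.inner_starProjection_left_eq_right V.toClosedSubmodule.toSubmodule x y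

theorem re_inner_sub_proj {v : H} (hv : v ∈ V.toClosedSubmodule) (x : H) :
    (inner ℂ v (x - V.proj x)).re = 0 := by
  rw [inner_sub_right, Complex.sub_re, ← re_inner_proj, V.proj_of_mem hv, sub_self]

theorem proj_eq_of_forall {x y : H} (hy : y ∈ V.toClosedSubmodule)
    (h : ∀ v ∈ V.toClosedSubmodule, (inner ℂ v (x - y)).re = 0) : V.proj x = y :=
  Submodule.eq_starProjection_of_mem_orthogonal hy
    ((Submodule.mem_orthogonal _ _).2 h)

theorem proj_I_smul (x : H) : V.proj (Complex.I • x) = Complex.I • V.projI x := by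
  rw [projI_apply, smul_neg, smul_smul, Complex.I_mul_I, neg_one_smul, neg_neg]

theorem projI_I_smul (x : H) : V.projI (Complex.I • x) = Complex.I • V.proj x := by
  rw [projI_apply, smul_smul, Complex.I_mul_I, neg_one_smul, map_neg, smul_neg, neg_neg]

theorem projI_projI (x : H) : V.projI (V.projI x) = V.projI x := by
  rw [V.projI_apply (V.projI x), ← proj_I_smul, proj_proj, ← projI_apply]

theorem re_inner_projI (x y : H) : (inner ℂ (V.projI x) y).re = (inner ℂ x (V.projI y)).re := by
  have h := V.re_inner_proj (Complex.I • x) (Complex.I • y)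
  rw [proj_I_smul, proj_I_smul] at h
  simpa [inner_smul_left, inner_smul_right, ← mul_assoc] using h

theorem im_inner_sub_projI {v : H} (hv : v ∈ V.toClosedSubmodule) (x : H) :
    (inner ℂ v (x - V.projI x)).im = 0 := by
  have h := V.re_inner_sub_proj hv (Complex.I • x)
  rw [proj_I_smul, ← smul_sub, inner_smul_right] at h
  simpa only [Complex.I_mul_re, neg_eq_zero] using h

theorem projI_eq_zero_iff (x : H) :
    V.projI x = 0 ↔ ∀ v ∈ V.toClosedSubmodule, (inner ℂ v x).im = 0 := by
  constructor
  · intro h v hv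
    simpa [h] using V.im_inner_sub_projI hv x
  · intro h
    rw [projI_apply, V.proj_eq_of_forall (zero_mem _), smul_zero, neg_zero]
    intro v hv
    simpa [inner_smul_right] using h v hv

omit [CompleteSpace H] in
theorem eq_zero_of_mem_of_I_smul_mem {v : H} (hv : v ∈ V.toClosedSubmodule)
    (hi : Complex.I • v ∈ V.toClosedSubmodule) : v = 0 := by
  have : Complex.I • v ∈ V.toClosedSubmodule ⊓ V.toClosedSubmodule.mulI := by
    refine ⟨hi, ?_⟩
    exact (mem_mapEquiv_iff' (scalarSMulCLE H Complex.UnitI) _ v).2 hv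
  rw [V.IsSeparating] at this
  simpa using this

omit [CompleteSpace H] in
theorem eq_zero_of_forall_inner {x : H} (h : ∀ v ∈ V.toClosedSubmodule, inner ℂ v x = 0) :
    x = 0 := by
  have : x ∈ (V.toClosedSubmodule ⊔ V.toClosedSubmodule.mulI)ᗮ := by
    rw [← ClosedSubmodule.inf_orthogonal]
    refine ⟨(ClosedSubmodule.mem_orthogonal _ _).2 fun v hv => ?_,
      (mem_symplComp_iff (S := V.toClosedSubmodule)).2 fun v hv => ?_⟩
    · rw [inner_real_eq_re_inner, h v hv, Complex.zero_re]
    · rw [h v hv, Complex.zero_im]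
  rw [V.IsCyclic] at this
  have h' := (ClosedSubmodule.mem_orthogonal _ _).1 this x trivial
  exact inner_self_eq_zero.1 h'

/-- The antilinear operator `P - Q`. -/
noncomputable def projDiff : H →L⋆[ℂ] H :=
  (V.proj - V.projI).antilinearOfReal fun x => by
    simp [proj_I_smul, projI_I_smul, smul_sub]

/-- The complex-linear operator `P + Q`. -/
noncomputable def projSum : H →L[ℂ] H :=
  (V.proj + V.projI).complexLinearOfReal fun x => by
    simp [proj_I_smul, projI_I_smul, smul_add, add_comm]

theorem projDiff_apply (x : H) : V.projDiff x = V.proj x - V.projI x := rfl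

theorem projSum_apply (x : H) : V.projSum x = V.proj x + V.projI x := rfl

theorem inner_projDiff (x y : H) : inner ℂ (V.projDiff x) y = inner ℂ (V.projDiff y) x := by
  have h : ∀ x y : H, (inner ℂ (V.projDiff x) y).re = (inner ℂ (V.projDiff y) x).re := by
    intro x y
    have h1 := inner_re_symm (𝕜 := ℂ) x (V.projDiff y)
    simp only [RCLike.re_eq_complex_re] at h1
    rw [← h1]
    simp only [projDiff_apply, inner_sub_left, inner_sub_right, Complex.sub_re, re_inner_proj,
      re_inner_projI]
  apply Complex.ext (h x y)
  have := h (Complex.I • x) y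
  simpa [inner_smul_left, inner_smul_right, ContinuousLinearMap.map_smulₛₗ] using this

theorem inner_projSum (x y : H) : inner ℂ (V.projSum x) y = inner ℂ x (V.projSum y) := by
  have h : ∀ x y : H, (inner ℂ (V.projSum x) y).re = (inner ℂ x (V.projSum y)).re := by
    intro x y
    simp only [projSum_apply, inner_add_left, inner_add_right, Complex.add_re, re_inner_proj,
      re_inner_projI]
  apply Complex.ext (h x y)
  have := h (Complex.I • x) y
  simpa [inner_smul_left] using this

theorem re_inner_projSum_self (x : H) :
    (inner ℂ x (V.projSum x)).re = ‖V.proj x‖ ^ 2 + ‖V.projI x‖ ^ 2 := by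
  have h : ∀ y : H, (inner ℂ y y).re = ‖y‖ ^ 2 := fun y => inner_self_eq_norm_sq (𝕜 := ℂ) y
  rw [projSum_apply, inner_add_right, Complex.add_re, ← V.proj_proj x, ← V.projI_projI x,
    ← re_inner_proj, ← re_inner_projI, proj_proj, projI_projI, h, h]

theorem eq_zero_of_proj_eq_zero {x : H} (hP : V.proj x = 0) (hQ : V.projI x = 0) : x = 0 := by
  refine V.eq_zero_of_forall_inner fun v hv => Complex.ext ?_ ?_
  · simpa [hP] using V.re_inner_sub_proj hv x
  · simpa [hQ] using V.im_inner_sub_projI hv x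

theorem projSum_nonneg : 0 ≤ V.projSum :=
  ContinuousLinearMap.nonneg_of_symmetric V.inner_projSum fun x => by
    rw [re_inner_projSum_self]
    positivity

theorem eq_zero_of_projSum_eq_zero {x : H} (hx : V.projSum x = 0) : x = 0 := by
  have h := V.re_inner_projSum_self x
  rw [hx, inner_zero_right, Complex.zero_re] at h
  refine V.eq_zero_of_proj_eq_zero ?_ ?_
  · rw [← norm_eq_zero]
    nlinarith [sq_nonneg ‖V.proj x‖, sq_nonneg ‖V.projI x‖]
  · rw [← norm_eq_zero]
    nlinarith [sq_nonneg ‖V.proj x‖, sq_nonneg ‖V.projI x‖]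

/-- Injectivity of `P - Q`: this is where `V ∩ i V = 0` enters. -/
theorem eq_zero_of_projDiff_eq_zero {x : H} (hx : V.projDiff x = 0) : x = 0 := by
  rw [projDiff_apply, sub_eq_zero] at hx
  have hQ : V.projI x = 0 := V.eq_zero_of_mem_of_I_smul_mem (hx ▸ V.proj_mem x) <| by
    rw [← proj_I_smul]
    exact V.proj_mem _
  exact V.eq_zero_of_proj_eq_zero (hx.trans hQ) hQ

/-- The positive complex-linear operator `(P - Q) ^ 2`. -/
noncomputable def projDiffSq : H →L[ℂ] H := V.projDiff.comp V.projDiff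

theorem projDiffSq_apply (x : H) : V.projDiffSq x = V.projDiff (V.projDiff x) := rfl

theorem inner_projDiffSq (x y : H) :
    inner ℂ (V.projDiffSq x) y = inner ℂ (V.projDiff y) (V.projDiff x) := by
  rw [projDiffSq_apply, inner_projDiff]

theorem projDiffSq_nonneg : 0 ≤ V.projDiffSq := by
  refine ContinuousLinearMap.nonneg_of_symmetric (fun x y => ?_) fun x => ?_
  · rw [inner_projDiffSq, ← inner_conj_symm x, inner_projDiffSq, inner_conj_symm]
  · rw [← inner_conj_symm, Complex.conj_re, inner_projDiffSq]
    exact inner_self_nonneg (𝕜 := ℂ)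

theorem projDiffSq_proj (x : H) : V.proj (V.projDiffSq x) = V.projDiffSq (V.proj x) := by
  simp only [projDiffSq_apply, projDiff_apply, map_sub, proj_proj, projI_projI]
  abel

theorem projDiff_proj (x : H) :
    V.projDiff (V.proj x) = V.projDiff x - V.projI (V.projDiff x) := by
  simp only [projDiff_apply, map_sub, proj_proj, projI_projI]
  abel

end StandardSubspace

/-! ### The modular conjugation as the sign of `P - Q` -/

namespace StandardSubspace

open ClosedSubmodule

variable {H : Type*} [NormedAddCommGroup H] [InnerProductSpace ℂ H] [CompleteSpace H]

/-- `P - Q = J T` is the polar decomposition of the bounded injective operator `P - Q`. The modular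
conjugation of `V` is characterized as its antiunitary factor `J`. -/
structure IsModularPair (V : StandardSubspace H) (J : H ≃ₗᵢ⋆[ℂ] H) (T : H →L[ℂ] H) : Prop where
  nonneg : 0 ≤ T
  map_apply : ∀ x, J (T x) = V.projDiff x

namespace IsModularPair

variable {V : StandardSubspace H} {J : H ≃ₗᵢ⋆[ℂ] H} {T : H →L[ℂ] H}

theorem mul_self (h : V.IsModularPair J T) : T * T = V.projDiffSq := by
  ext x
  refine ext_inner_right ℂ fun y => ?_
  rw [inner_projDiffSq, ← h.map_apply, ← h.map_apply, J.inner_map_map_of_antiunitary,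
    ← ContinuousLinearMap.inner_symm_of_nonneg h.nonneg]
  rfl

theorem apply_apply (h : V.IsModularPair J T) (x : H) : T (T x) = V.projDiffSq x :=
  congrArg (fun M : H →L[ℂ] H => M x) h.mul_self

theorem eq_sqrt (h : V.IsModularPair J T) : T = CFC.sqrt V.projDiffSq :=
  (CFC.sqrt_unique h.mul_self h.nonneg).symm

theorem eq_zero_of_apply_eq_zero (h : V.IsModularPair J T) {x : H} (hx : T x = 0) : x = 0 :=
  V.eq_zero_of_projDiff_eq_zero (by rw [← h.map_apply, hx, map_zero])

theorem denseRange (h : V.IsModularPair J T) : DenseRange T :=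
  ContinuousLinearMap.denseRange_of_symmetric
    (ContinuousLinearMap.inner_symm_of_nonneg h.nonneg) fun _ => h.eq_zero_of_apply_eq_zero

theorem unique {J' : H ≃ₗᵢ⋆[ℂ] H} {T' : H →L[ℂ] H} (h : V.IsModularPair J T)
    (h' : V.IsModularPair J' T') : J = J' := by
  have hT : T = T' := h.eq_sqrt.trans h'.eq_sqrt.symm
  refine LinearIsometryEquiv.ext fun x => ?_
  refine h.denseRange.induction_on x (isClosed_eq J.continuous J'.continuous) fun u => ?_
  rw [h.map_apply, hT, h'.map_apply]

theorem map_apply_comm (h : V.IsModularPair J T) (B : H →L[ℝ] H)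
    (hB : ∀ x, B (V.projDiffSq x) = V.projDiffSq (B x)) (x : H) : B (T x) = T (B x) := by
  rw [h.eq_sqrt]
  exact ContinuousLinearMap.map_sqrt_apply V.projDiffSq_nonneg B hB x

theorem proj_apply (h : V.IsModularPair J T) (x : H) : V.proj (T x) = T (V.proj x) :=
  h.map_apply_comm _ V.projDiffSq_proj x

theorem projDiff_apply_comm (h : V.IsModularPair J T) (x : H) :
    V.projDiff (T x) = T (V.projDiff x) :=
  h.map_apply_comm (V.proj - V.projI) (fun _ => rfl) x

theorem apply_conj (h : V.IsModularPair J T) (x : H) : T (J x) = J (T x) := by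
  refine h.denseRange.induction_on x (isClosed_eq (T.continuous.comp J.continuous)
    (J.continuous.comp T.continuous)) fun u => ?_
  rw [h.map_apply, h.map_apply, h.projDiff_apply_comm]

theorem conj_conj (h : V.IsModularPair J T) (x : H) : J (J x) = x := by
  refine h.denseRange.induction_on x (isClosed_eq (J.continuous.comp J.continuous)
    continuous_id) fun u => ?_
  refine h.denseRange.induction_on u (isClosed_eq (J.continuous.comp <|
    J.continuous.comp T.continuous) T.continuous) fun w => ?_
  rw [← h.apply_conj, h.map_apply, h.map_apply, h.apply_apply, projDiffSq_apply]

/-- `J` intertwines the projection onto `V` with the projection onto the symplectic complement. -/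
theorem conj_proj (h : V.IsModularPair J T) (x : H) :
    J (V.proj x) = J x - V.projI (J x) := by
  refine h.denseRange.induction_on x (isClosed_eq (J.continuous.comp V.proj.continuous)
    (J.continuous.sub (V.projI.continuous.comp J.continuous))) fun u => ?_
  rw [h.proj_apply, h.map_apply, h.map_apply, projDiff_proj]

theorem im_inner_conj (h : V.IsModularPair J T) {v w : H} (hv : v ∈ V.toClosedSubmodule)
    (hw : w ∈ V.toClosedSubmodule) : (inner ℂ v (J w)).im = 0 := by
  refine (V.projI_eq_zero_iff _).1 ?_ v hv
  have := h.conj_proj w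
  rwa [V.proj_of_mem hw, eq_comm, sub_eq_self] at this

/-- `J` maps the symplectic complement of `V` into `V`. -/
theorem conj_mem (h : V.IsModularPair J T) {z : H}
    (hz : ∀ v ∈ V.toClosedSubmodule, (inner ℂ v z).im = 0) : J z ∈ V.toClosedSubmodule := by
  have := h.conj_proj (J z)
  rw [h.conj_conj, (V.projI_eq_zero_iff z).2 hz, sub_zero] at this
  have h' := V.proj_mem (J z)
  rwa [← h.conj_conj (V.proj (J z)), this] at h'

theorem re_inner_conj_nonneg (h : V.IsModularPair J T) {v : H} (hv : v ∈ V.toClosedSubmodule) :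
    0 ≤ (inner ℂ v (J v)).re := by
  let JR : H →L[ℝ] H :=
    { toFun := J
      map_add' := map_add J
      map_smul' := fun r x => by
        simpa using J.map_smulₛₗ (r : ℂ) x
      cont := J.continuous }
  have hJR : ∀ x, JR x = J x := fun _ => rfl
  -- `P J P` is positive, since `T (P J P) = P (P - Q) P` is.
  have key := ContinuousLinearMap.re_inner_nonneg_of_commute h.nonneg
    (fun _ => h.eq_zero_of_apply_eq_zero) (V.proj ∘L JR ∘L V.proj)
    (fun x => by
      simp only [ContinuousLinearMap.comp_apply, hJR, h.proj_apply, ← h.apply_conj])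
    (fun x => by
      simp only [ContinuousLinearMap.comp_apply, hJR]
      rw [← re_inner_proj, h.proj_apply, ContinuousLinearMap.inner_symm_of_nonneg h.nonneg,
        h.apply_conj, h.map_apply, projDiff_apply, proj_proj, inner_sub_right, Complex.sub_re]
      have h1 := inner_self_nonneg (𝕜 := ℂ) (x := V.proj x - V.projI (V.proj x))
      have h2 := V.re_inner_projI (V.proj x) (V.proj x)
      have h3 := V.re_inner_projI (V.proj x) (V.projI (V.proj x))
      rw [projI_projI] at h3
      simp only [inner_sub_left, inner_sub_right, map_sub, RCLike.re_eq_complex_re] at h1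
      linarith) v
  simp only [ContinuousLinearMap.comp_apply, hJR] at key
  rwa [← re_inner_proj, V.proj_of_mem hv] at key

end IsModularPair

theorem exists_isModularPair (V : StandardSubspace H) :
    ∃ (J : H ≃ₗᵢ⋆[ℂ] H) (T : H →L[ℂ] H), V.IsModularPair J T := by
  have hT : 0 ≤ (CFC.sqrt V.projDiffSq : H →L[ℂ] H) := CFC.sqrt_nonneg _
  have hTT := ContinuousLinearMap.sqrt_apply_sqrt_apply V.projDiffSq_nonneg
  generalize (CFC.sqrt V.projDiffSq : H →L[ℂ] H) = T at hT hTT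
  -- An auxiliary antiunitary `K` turns `P - Q` into the linear map `D = (P - Q) K⁻¹`; then `J` is
  -- the isometric extension of `T x ↦ D (K x)`.
  obtain ⟨K⟩ := nonempty_antiunitary (H := H)
  let D : H →ₗ[ℂ] H := (V.projDiff : H →ₛₗ[starRingEnd ℂ] H).comp
    (K.symm.toLinearEquiv : H →ₛₗ[starRingEnd ℂ] H)
  have hD : ∀ x, D (K x) = V.projDiff x := fun x =>
    congrArg V.projDiff (K.symm_apply_apply x)
  have hdT : DenseRange (T : H →ₗ[ℂ] H) := ContinuousLinearMap.denseRange_of_symmetric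
    (ContinuousLinearMap.inner_symm_of_nonneg hT) fun x hx =>
      V.eq_zero_of_projDiff_eq_zero <| V.eq_zero_of_projDiff_eq_zero <| by
        rw [← projDiffSq_apply, ← hTT, hx, map_zero]
  have hdD : DenseRange D := by
    have := Submodule.dense_of_forall_inner_eq_zero (LinearMap.range D) fun x hx =>
      V.eq_zero_of_projDiff_eq_zero <| by
        rw [← inner_self_eq_zero (𝕜 := ℂ), inner_projDiff, ← hD]
        exact hx _ ⟨_, rfl⟩
    rwa [DenseRange, ← LinearMap.coe_range]
  have hn : ∀ x, ‖D (K.toLinearEquiv x)‖ = ‖(T : H →ₗ[ℂ] H) x‖ := by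
    intro x
    have h1 : ‖V.projDiff x‖ ^ 2 = ‖T x‖ ^ 2 := by
      rw [← inner_self_eq_norm_sq (𝕜 := ℂ), ← inner_self_eq_norm_sq (𝕜 := ℂ),
        ← inner_projDiffSq, ← hTT, ContinuousLinearMap.inner_symm_of_nonneg hT]
    have h2 : D (K.toLinearEquiv x) = V.projDiff x := hD x
    rw [h2]
    exact (sq_eq_sq₀ (norm_nonneg _) (norm_nonneg _)).1 h1
  exact ⟨K.toLinearEquiv.extendOfIsometry (T : H →ₗ[ℂ] H) D hdT hdD hn, T, hT, fun x =>
    (LinearEquiv.extendOfIsometry_eq _ _ _ hdT hdD hn x).trans (hD x)⟩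

end StandardSubspace

/-! ### The polar decomposition of the Tomita operator -/

namespace StandardSubspace

open ClosedSubmodule

section

variable {H : Type*} [NormedAddCommGroup H] [InnerProductSpace ℂ H] (V : StandardSubspace H)

theorem mem_tomitaGraph_of_mem {v : H} (hv : v ∈ V.toClosedSubmodule) :
    (v, v) ∈ V.tomitaGraph := ⟨v, hv, 0, zero_mem _, by simp⟩

theorem add_mem_tomitaGraph {p q : H × H} (hp : p ∈ V.tomitaGraph) (hq : q ∈ V.tomitaGraph) :
    p + q ∈ V.tomitaGraph := by
  obtain ⟨v, hv, w, hw, rfl⟩ := hp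
  obtain ⟨v', hv', w', hw', rfl⟩ := hq
  refine ⟨v + v', add_mem hv hv', w + w', add_mem hw hw', Prod.ext ?_ ?_⟩
  · simp only [Prod.fst_add, smul_add]
    abel
  · simp only [Prod.snd_add, smul_add]
    abel

theorem smul_mem_tomitaGraph {p : H × H} (hp : p ∈ V.tomitaGraph) (c : ℂ) :
    (c • p.1, conj c • p.2) ∈ V.tomitaGraph := by
  obtain ⟨v, hv, w, hw, rfl⟩ := hp
  refine ⟨c.re • v - c.im • w, V.toClosedSubmodule.toSubmodule.sub_mem
      (SMulMemClass.smul_mem _ hv) (SMulMemClass.smul_mem _ hw),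
    c.im • v + c.re • w, add_mem (SMulMemClass.smul_mem _ hv) (SMulMemClass.smul_mem _ hw), ?_⟩
  have h : ∀ (r : ℝ) (y : H), r • y = (r : ℂ) • y := fun _ _ => rfl
  refine Prod.ext ?_ ?_
  · conv_lhs => rw [← Complex.re_add_im c]
    simp only [h]
    match_scalars <;> first | ring1 | linear_combination (c.im : ℂ) * Complex.I_mul_I
  · conv_lhs => rw [← Complex.re_add_im c]
    simp only [h, map_add, map_mul, Complex.conj_ofReal, Complex.conj_I]
    match_scalars <;> first | ring1 | linear_combination (c.im : ℂ) * Complex.I_mul_I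

theorem eq_zero_of_mem_tomitaGraph {x : H} (h : (0, x) ∈ V.tomitaGraph) : x = 0 := by
  obtain ⟨v, hv, w, hw, h⟩ := h
  obtain ⟨h1, h2⟩ := Prod.ext_iff.1 h
  have hvw : v = -(Complex.I • w) := eq_neg_of_add_eq_zero_left h1.symm
  have hw0 : w = 0 := V.eq_zero_of_mem_of_I_smul_mem hw <| by
    rw [← neg_neg (Complex.I • w), ← hvw]
    exact V.toClosedSubmodule.toSubmodule.neg_mem hv
  rw [hw0, smul_zero, neg_zero] at hvw
  simpa [hw0, hvw] using h2

/-- The graph of `J⁻¹ S`, where `S` is the Tomita operator of `V`. -/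
def conjTomitaGraph (J : H ≃ₗᵢ⋆[ℂ] H) : Submodule ℂ (H × H) where
  carrier := {p | (p.1, J p.2) ∈ V.tomitaGraph}
  add_mem' {p q} hp hq := by
    simpa using V.add_mem_tomitaGraph hp hq
  zero_mem' := by simpa using V.mem_tomitaGraph_of_mem (zero_mem _)
  smul_mem' c p hp := by
    simpa [LinearIsometryEquiv.map_smulₛₗ] using V.smul_mem_tomitaGraph hp c

theorem mem_conjTomitaGraph_iff {J : H ≃ₗᵢ⋆[ℂ] H} {x y : H} :
    (x, y) ∈ V.conjTomitaGraph J ↔ (x, J y) ∈ V.tomitaGraph := Iff.rfl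

theorem conjTomitaGraph_functional (J : H ≃ₗᵢ⋆[ℂ] H) (p : H × H)
    (hp : p ∈ V.conjTomitaGraph J) (h0 : p.1 = 0) : p.2 = 0 := by
  obtain ⟨x, y⟩ := p
  obtain rfl : x = 0 := h0
  exact J.map_eq_zero_iff.1 (V.eq_zero_of_mem_tomitaGraph hp)

end

variable {H : Type*} [NormedAddCommGroup H] [InnerProductSpace ℂ H] [CompleteSpace H]
  {V : StandardSubspace H} {J : H ≃ₗᵢ⋆[ℂ] H} {T : H →L[ℂ] H}

namespace IsModularPair

theorem mem_conjTomitaGraph_iff (h : V.IsModularPair J T) {x y : H} :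
    (x, y) ∈ V.conjTomitaGraph J ↔ ∃ v ∈ V.toClosedSubmodule, ∃ w ∈ V.toClosedSubmodule,
      x = v + Complex.I • w ∧ y = J v + Complex.I • J w := by
  rw [StandardSubspace.mem_conjTomitaGraph_iff]
  constructor
  · rintro ⟨v, hv, w, hw, hvw⟩
    obtain ⟨h1, h2⟩ := Prod.ext_iff.1 hvw
    refine ⟨v, hv, w, hw, h1, ?_⟩
    rw [← h.conj_conj y, show J y = _ from h2]
    simp [LinearIsometryEquiv.map_smulₛₗ]
  · rintro ⟨v, hv, w, hw, rfl, rfl⟩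
    refine ⟨v, hv, w, hw, Prod.ext rfl ?_⟩
    simp [LinearIsometryEquiv.map_smulₛₗ, h.conj_conj, sub_eq_add_neg]

theorem inner_conj_comm (h : V.IsModularPair J T) {v w : H} (hv : v ∈ V.toClosedSubmodule)
    (hw : w ∈ V.toClosedSubmodule) : inner ℂ (J v) w = inner ℂ v (J w) := by
  rw [← J.inner_map_map_of_antiunitary, h.conj_conj, ← inner_conj_symm, Complex.conj_eq_iff_im]
  exact h.im_inner_conj hv hw

/-- `J S` is self-adjoint. The adjoint of `S` is the Tomita operator of the symplectic complement
`V' = J V`, so that `(J S)* = S* J = J S`. -/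
theorem conjTomitaGraph_adjoint (h : V.IsModularPair J T) :
    (V.conjTomitaGraph J).adjoint = V.conjTomitaGraph J := by
  ext ⟨x, y⟩
  rw [Submodule.mem_adjoint_iff]
  constructor
  · intro hxy
    have hv : ∀ v ∈ V.toClosedSubmodule, inner ℂ (J x) v = inner ℂ v y := fun v hv => by
      have := hxy v (J v) (h.mem_conjTomitaGraph_iff.2 ⟨v, hv, 0, zero_mem _, by simp, by simp⟩)
      rw [sub_eq_zero] at this
      rw [← this]
      nth_rewrite 2 [← h.conj_conj x]
      exact (J.inner_map_map_of_antiunitary _ _).symm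
    -- `y + J x` and `i (y - J x)` lie in `V'`, which `J` maps to `V`.
    have h1 : J (y + J x) ∈ V.toClosedSubmodule := h.conj_mem fun v hv' => by
      rw [inner_add_right, ← hv v hv', ← inner_conj_symm v (J x)]
      simp [-inner_conj_symm]
    have h2 : J (Complex.I • (y - J x)) ∈ V.toClosedSubmodule := h.conj_mem fun v hv' => by
      rw [inner_smul_right, inner_sub_right, ← hv v hv', ← inner_conj_symm v (J x)]
      simp [-inner_conj_symm]
    refine ⟨(1 / 2 : ℝ) • J (y + J x), SMulMemClass.smul_mem _ h1,
      (-1 / 2 : ℝ) • J (Complex.I • (y - J x)), SMulMemClass.smul_mem _ h2, ?_⟩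
    have hr : ∀ (r : ℝ) (z : H), r • z = (r : ℂ) • z := fun _ _ => rfl
    simp only [hr, LinearIsometryEquiv.map_smulₛₗ, map_add, map_sub, h.conj_conj, Complex.conj_I]
    refine Prod.ext ?_ ?_
    · match_scalars <;>
        first
        | linear_combination (1 / 2 : ℂ) * Complex.I_mul_I
        | linear_combination (-1 / 2 : ℂ) * Complex.I_mul_I
    · match_scalars <;>
        first
        | linear_combination (1 / 2 : ℂ) * Complex.I_mul_I
        | linear_combination (-1 / 2 : ℂ) * Complex.I_mul_I
  · intro hxy a b hab
    obtain ⟨v, hv, w, hw, rfl, rfl⟩ := h.mem_conjTomitaGraph_iff.1 hab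
    obtain ⟨v', hv', w', hw', rfl, rfl⟩ := h.mem_conjTomitaGraph_iff.1 hxy
    simp only [inner_add_left, inner_add_right, inner_smul_left, inner_smul_right,
      h.inner_conj_comm hv hv', h.inner_conj_comm hv hw', h.inner_conj_comm hw hv',
      h.inner_conj_comm hw hw']
    ring

theorem exists_isPolarDecomposition (h : V.IsModularPair J T) :
    ∃ A : H →ₗ.[ℂ] H, V.IsPolarDecomposition J A := by
  have hg := Submodule.toLinearPMap_graph_eq _ (V.conjTomitaGraph_functional J)
  have hd : Dense ((V.conjTomitaGraph J).toLinearPMap.domain : Set H) :=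
    Submodule.dense_of_forall_inner_eq_zero _ fun x hx => V.eq_zero_of_forall_inner fun v hv =>
      hx v <| by
        rw [LinearPMap.mem_domain_iff]
        refine ⟨J v, ?_⟩
        rw [hg]
        exact h.mem_conjTomitaGraph_iff.2 ⟨v, hv, 0, zero_mem _, by simp, by simp⟩
  refine ⟨(V.conjTomitaGraph J).toLinearPMap, LinearPMap.eq_of_eq_graph ?_, fun x => ?_,
    fun x y => ?_⟩
  · change (LinearPMap.adjoint _).graph = _
    rw [LinearPMap.adjoint_graph_eq_graph_adjoint hd, hg, h.conjTomitaGraph_adjoint]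
  · have hx := LinearPMap.mem_graph _ x
    rw [hg] at hx
    generalize (V.conjTomitaGraph J).toLinearPMap x = y at hx ⊢
    obtain ⟨v, hv, w, hw, h1, rfl⟩ := h.mem_conjTomitaGraph_iff.1 hx
    rw [h1]
    have hvv := h.re_inner_conj_nonneg hv
    have hww := h.re_inner_conj_nonneg hw
    simp [h.im_inner_conj hv hw, h.im_inner_conj hw hv]
    linarith
  · rw [hg]
    rfl

end IsModularPair

end StandardSubspace

/-! ### Uniqueness of the polar decomposition of the Tomita operator -/

namespace StandardSubspace

variable {H : Type*} [NormedAddCommGroup H] [InnerProductSpace ℂ H] [CompleteSpace H]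
  {V : StandardSubspace H} {J : H ≃ₗᵢ⋆[ℂ] H} {A : H →ₗ.[ℂ] H}

/-- The operator `P + Q` maps into `V + i V`, and `S (P + Q) = P - Q`. -/
theorem projSum_projDiff_mem_tomitaGraph (V : StandardSubspace H) (x : H) :
    (V.projSum x, V.projDiff x) ∈ V.tomitaGraph := by
  refine ⟨V.proj x, V.proj_mem x, -V.proj (Complex.I • x),
    V.toClosedSubmodule.toSubmodule.neg_mem (V.proj_mem _), Prod.ext ?_ ?_⟩
  · rw [projSum_apply, projI_apply, smul_neg]
  · rw [projDiff_apply, projI_apply, smul_neg]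

theorem inner_projDiff_of_mem (V : StandardSubspace H) {v : H} (hv : v ∈ V.toClosedSubmodule)
    (x : H) : inner ℂ (V.projDiff x) v = inner ℂ v ((2 : ℂ) • x - V.projSum x) := by
  have h1 := V.re_inner_sub_proj hv x
  have h2 := V.im_inner_sub_projI hv x
  rw [← inner_conj_symm]
  rw [inner_sub_right] at h1 h2
  simp only [Complex.sub_re, Complex.sub_im] at h1 h2
  apply Complex.ext
  · simp only [projDiff_apply, projSum_apply, inner_sub_right, inner_add_right, inner_smul_right,
      Complex.conj_re, Complex.sub_re, Complex.add_re, two_mul]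
    linarith
  · simp only [projDiff_apply, projSum_apply, inner_sub_right, inner_add_right, inner_smul_right,
      Complex.conj_im, Complex.sub_im, Complex.add_im, two_mul]
    linarith

namespace IsPolarDecomposition

theorem inner_symm (h : V.IsPolarDecomposition J A) {a b c d : H} (hab : (a, b) ∈ A.graph)
    (hcd : (c, d) ∈ A.graph) : inner ℂ b c = inner ℂ a d := by
  have hg := LinearPMap.adjoint_graph_eq_graph_adjoint h.isSelfAdjoint.dense_domain
  rw [LinearPMap.isSelfAdjoint_def.1 h.isSelfAdjoint] at hg
  rw [hg] at hcd
  exact sub_eq_zero.1 ((Submodule.mem_adjoint_iff _ _).1 hcd a b hab)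

/-- A self-adjoint operator has no proper symmetric extension: `A* ⊆ A` in terms of graphs. -/
theorem mem_graph_of_forall (h : V.IsPolarDecomposition J A) {x y : H}
    (hxy : ∀ a b, (a, b) ∈ A.graph → inner ℂ b x = inner ℂ a y) : (x, y) ∈ A.graph := by
  have hg := LinearPMap.adjoint_graph_eq_graph_adjoint h.isSelfAdjoint.dense_domain
  rw [LinearPMap.isSelfAdjoint_def.1 h.isSelfAdjoint] at hg
  rw [hg]
  exact (Submodule.mem_adjoint_iff _ _).2 fun a b hab => sub_eq_zero.2 (hxy a b hab)

theorem re_inner_nonneg (h : V.IsPolarDecomposition J A) {x y : H} (hxy : (x, y) ∈ A.graph) :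
    0 ≤ (inner ℂ x y).re := by
  obtain ⟨z, rfl, rfl⟩ := (LinearPMap.mem_graph_iff A).1 hxy
  exact h.nonneg z

/-- `A (P + Q) = J⁻¹ (P - Q)`. -/
theorem projSum_mem_graph (h : V.IsPolarDecomposition J A) (x : H) :
    (V.projSum x, J.symm (V.projDiff x)) ∈ A.graph := by
  rw [h.graph_iff, J.apply_symm_apply]
  exact V.projSum_projDiff_mem_tomitaGraph x

/-- `A ^ 2 (P + Q) = 2 - (P + Q)`, so that `P + Q = 2 (1 + A ^ 2)⁻¹`. -/
theorem symm_projDiff_mem_graph (h : V.IsPolarDecomposition J A) (x : H) :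
    (J.symm (V.projDiff x), (2 : ℂ) • x - V.projSum x) ∈ A.graph := by
  refine h.mem_graph_of_forall fun a b hab => ?_
  obtain ⟨v, hv, w, hw, hvw⟩ := (h.graph_iff a b).1 hab
  obtain ⟨h1, h2⟩ := Prod.ext_iff.1 hvw
  dsimp only at h1 h2
  rw [J.inner_eq_inner_antiunitary, h1, h2, inner_sub_right, inner_add_left, inner_smul_right,
    inner_smul_left, V.inner_projDiff_of_mem hv, V.inner_projDiff_of_mem hw, Complex.conj_I]
  ring

/-- `A` commutes with `P + Q`, as `P + Q = 2 (1 + A ^ 2)⁻¹` and `1 + A ^ 2` is injective. -/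
theorem symm_projDiff_eq_projSum (h : V.IsPolarDecomposition J A) {x y : H}
    (hxy : (x, y) ∈ A.graph) : J.symm (V.projDiff x) = V.projSum y := by
  -- With `u = J⁻¹ (P - Q) x - (P + Q) y` and `u' = A u`, these say that `A u' = -u`, so that
  -- `‖u'‖ ^ 2 = -‖u‖ ^ 2`.
  have h1 := A.graph.sub_mem (h.symm_projDiff_mem_graph x) (h.projSum_mem_graph y)
  have h2 := A.graph.sub_mem (A.graph.sub_mem (A.graph.smul_mem (2 : ℂ) hxy)
    (h.projSum_mem_graph x)) (h.symm_projDiff_mem_graph y)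
  have h3 := h.inner_symm h1 h2
  dsimp only [Prod.mk_sub_mk, Prod.smul_mk] at h3
  have e : (2 : ℂ) • y - J.symm (V.projDiff x) - ((2 : ℂ) • y - V.projSum y) =
    -(J.symm (V.projDiff x) - V.projSum y) := by abel
  rw [e, inner_neg_right] at h3
  have h4 := congrArg Complex.re h3
  rw [Complex.neg_re] at h4
  have h5 := inner_self_nonneg (𝕜 := ℂ) (x := (2 : ℂ) • x - V.projSum x - J.symm (V.projDiff y))
  have h6 := inner_self_nonneg (𝕜 := ℂ) (x := J.symm (V.projDiff x) - V.projSum y)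
  simp only [RCLike.re_eq_complex_re] at h5 h6
  have h7 : (inner ℂ (J.symm (V.projDiff x) - V.projSum y)
      (J.symm (V.projDiff x) - V.projSum y)).re = 0 := by linarith
  rw [← sub_eq_zero, ← norm_eq_zero, ← sq_eq_zero_iff, ← inner_self_eq_norm_sq (𝕜 := ℂ)]
  exact h7

/-- The unbounded polar decomposition `S = J A` yields the bounded one `P - Q = J A (P + Q)`. -/
theorem exists_isModularPair (h : V.IsPolarDecomposition J A) :
    ∃ T : H →L[ℂ] H, V.IsModularPair J T := by
  let T : H →L[ℂ] H := (J.symm.toContinuousLinearEquiv : H →L⋆[ℂ] H).comp V.projDiff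
  have hT : ∀ x, T x = J.symm (V.projDiff x) := fun _ => rfl
  have hgr : ∀ x, (V.projSum x, T x) ∈ A.graph := h.projSum_mem_graph
  have hcomm : ∀ x, T (V.projSum x) = V.projSum (T x) := fun x =>
    h.symm_projDiff_eq_projSum (hgr x)
  have hinj : ∀ x, V.projSum x = 0 → x = 0 := fun _ => V.eq_zero_of_projSum_eq_zero
  have hsymm : ∀ x y, inner ℂ (T x) y = inner ℂ x (T y) := fun x y => by
    refine (ContinuousLinearMap.denseRange_of_symmetric V.inner_projSum hinj).induction_on x
      (isClosed_eq (by fun_prop) (by fun_prop)) fun z => ?_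
    rw [hcomm, V.inner_projSum, h.inner_symm (hgr z) (hgr y)]
  refine ⟨T, ContinuousLinearMap.nonneg_of_symmetric hsymm fun x => ?_, fun x => ?_⟩
  · exact ContinuousLinearMap.re_inner_nonneg_of_commute V.projSum_nonneg hinj
      (T.restrictScalars ℝ) hcomm (fun x => h.re_inner_nonneg (hgr x)) x
  · rw [hT, J.apply_symm_apply]

end IsPolarDecomposition

end StandardSubspace

/-! ### Covariance of the modular conjugation -/

namespace StandardSubspace

variable {H : Type*} [NormedAddCommGroup H] [InnerProductSpace ℂ H] [CompleteSpace H]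

theorem exists_isModularPair_modularConj (V : StandardSubspace H) :
    ∃ T : H →L[ℂ] H, V.IsModularPair V.modularConj T := by
  obtain ⟨J, T, h⟩ := V.exists_isModularPair
  obtain ⟨A, hA⟩ : ∃ A, V.IsPolarDecomposition V.modularConj A :=
    Classical.epsilon_spec (p := fun J => ∃ A, V.IsPolarDecomposition J A)
      ⟨J, h.exists_isPolarDecomposition⟩
  exact hA.exists_isModularPair

theorem IsModularPair.eq_modularConj {V : StandardSubspace H} {J : H ≃ₗᵢ⋆[ℂ] H} {T : H →L[ℂ] H}
    (h : V.IsModularPair J T) : J = V.modularConj :=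
  h.unique V.exists_isModularPair_modularConj.choose_spec

theorem modularConj_modularConj (V : StandardSubspace H) (x : H) :
    V.modularConj (V.modularConj x) = x :=
  V.exists_isModularPair_modularConj.choose_spec.conj_conj x

theorem proj_map (V : StandardSubspace H) (U : H ≃ₗᵢ[ℂ] H) (x : H) :
    (V.map U).proj x = U (V.proj (U.symm x)) := by
  refine (V.map U).proj_eq_of_forall ((mem_map_iff U V _).2 ⟨_, V.proj_mem _, rfl⟩) ?_
  intro y hy
  obtain ⟨v, hv, rfl⟩ := (mem_map_iff U V y).1 hy
  have h := V.re_inner_sub_proj hv (U.symm x)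
  rwa [← U.inner_map_map, map_sub, U.apply_symm_apply] at h

theorem projDiff_map (V : StandardSubspace H) (U : H ≃ₗᵢ[ℂ] H) (x : H) :
    (V.map U).projDiff x = U (V.projDiff (U.symm x)) := by
  simp [projDiff_apply, projI_apply, proj_map]

theorem modularConj_map (V : StandardSubspace H) (U : H ≃ₗᵢ[ℂ] H) (x : H) :
    (V.map U).modularConj x = U (V.modularConj (U.symm x)) := by
  obtain ⟨T, h⟩ := V.exists_isModularPair_modularConj
  have h' : (V.map U).IsModularPair ((U.symm.trans V.modularConj).trans U)
      ((U : H →L[ℂ] H) ∘L T ∘L (U.symm : H →L[ℂ] H)) := by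
    refine ⟨ContinuousLinearMap.nonneg_of_symmetric (fun x y => ?_) fun x => ?_, fun x => ?_⟩
    · have := ContinuousLinearMap.inner_symm_of_nonneg h.nonneg (U.symm x) (U.symm y)
      rw [← U.inner_map_map, ← U.inner_map_map (U.symm x)] at this
      simpa using this
    · have := ContinuousLinearMap.re_inner_nonneg_of_nonneg h.nonneg (U.symm x)
      rw [← U.inner_map_map] at this
      simpa using this
    · rw [projDiff_map, ← h.map_apply]
      simp
  rw [← h'.eq_modularConj]
  rfl

theorem modularConj_reflect (V W : StandardSubspace H) (x : H) :
    (V.reflect W).modularConj x = V.modularConj (W.modularConj (V.modularConj x)) := by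
  rw [reflect, modularConj_map]
  have h : ∀ V : StandardSubspace H, ∀ y, V.modularConj.symm y = V.modularConj y := fun V y => by
    rw [LinearIsometryEquiv.symm_apply_eq, modularConj_modularConj]
  simp [h, modularConj_modularConj]

end StandardSubspace

/-! ### One-parameter groups from geodesics -/

section Geodesic

variable {G : Type*} [Group G] {f : ℝ → G}

/-- A unital map from `ℝ` to a group that respects the reflections `(s, t) ↦ 2 s - t` and
`(g, h) ↦ g h⁻¹ g` is multiplicative along the multiples of each `s`. -/
theorem map_nat_mul_of_map_two_mul_sub (h0 : f 0 = 1)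
    (hf : ∀ s t, f (2 * s - t) = f s * (f t)⁻¹ * f s) (n : ℕ) (s : ℝ) :
    f (n * s) = f s ^ n := by
  induction n using Nat.twoStepInduction with
  | zero => simp [h0]
  | one => simp
  | more n h1 h2 =>
    have e : ((n + 2 : ℕ) : ℝ) * s = 2 * ((n + 1 : ℕ) * s) - n * s := by
      push_cast
      ring
    rw [e, hf, h1, h2]
    group

theorem map_int_mul_of_map_two_mul_sub (h0 : f 0 = 1)
    (hf : ∀ s t, f (2 * s - t) = f s * (f t)⁻¹ * f s) (n : ℤ) (s : ℝ) :
    f (n * s) = f s ^ n := by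
  have hneg : ∀ t, f (-t) = (f t)⁻¹ := fun t => by
    simpa [h0] using hf 0 t
  obtain ⟨m, rfl | rfl⟩ := n.eq_nat_or_neg
  · simpa using map_nat_mul_of_map_two_mul_sub h0 hf m s
  · rw [Int.cast_neg, neg_mul, hneg, zpow_neg]
    simpa using map_nat_mul_of_map_two_mul_sub h0 hf m s

theorem map_add_rat_of_map_two_mul_sub (h0 : f 0 = 1)
    (hf : ∀ s t, f (2 * s - t) = f s * (f t)⁻¹ * f s) (p q : ℚ) :
    f (p + q) = f p * f q := by
  -- Both rationals are integer multiples of the inverse of a common denominator.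
  obtain ⟨r, m, n, hp, hq⟩ : ∃ (r : ℝ) (m n : ℤ), (p : ℝ) = m * r ∧ (q : ℝ) = n * r := by
    have hpd : (p.den : ℝ) ≠ 0 := by exact_mod_cast p.den_nz
    have hqd : (q.den : ℝ) ≠ 0 := by exact_mod_cast q.den_nz
    refine ⟨((p.den : ℝ) * q.den)⁻¹, p.num * q.den, q.num * p.den, ?_, ?_⟩
    · rw [Rat.cast_def]
      push_cast
      field_simp
    · rw [Rat.cast_def]
      push_cast
      field_simp
  rw [hp, hq, ← add_mul, ← Int.cast_add]
  simp only [map_int_mul_of_map_two_mul_sub h0 hf, zpow_add]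

theorem isUnitaryOneParameterGroup_of_map_two_mul_sub {H : Type*} [NormedAddCommGroup H]
    [InnerProductSpace ℂ H] {U : ℝ → (H ≃ₗᵢ[ℂ] H)} (h0 : U 0 = 1)
    (hU : ∀ s t, U (2 * s - t) = U s * (U t)⁻¹ * U s)
    (hc : ∀ x : H, Continuous fun t => U t x) : IsUnitaryOneParameterGroup U := by
  refine ⟨fun s t => LinearIsometryEquiv.ext fun x => ?_, hc⟩
  have hQ : DenseRange ((↑) : ℚ → ℝ) := Rat.denseRange_cast
  change U (s + t) x = U s (U t x)
  refine hQ.induction_on s (isClosed_eq ((hc x).comp (by fun_prop)) (hc _)) fun p => ?_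
  refine hQ.induction_on t (isClosed_eq ((hc x).comp (by fun_prop))
    ((U p).continuous.comp (hc x))) fun q => ?_
  rw [map_add_rat_of_map_two_mul_sub h0 hU]
  rfl

end Geodesic

theorem proposition2p9 {H : Type*} [NormedAddCommGroup H] [InnerProductSpace ℂ H]
    [CompleteSpace H] (γ : ℝ → StandardSubspace H) (V : StandardSubspace H)
    (hγ : StandardSubspace.IsGeodesic γ) (h0 : γ 0 = V)
    (hcont : ∀ x : H, Continuous fun t : ℝ => (γ t).modularConj x) :
    ∃ U : ℝ → (H ≃ₗᵢ[ℂ] H),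
      IsUnitaryOneParameterGroup U ∧
      (∀ (t : ℝ) (x : H), V.modularConj (U t (V.modularConj x)) = U (-t) x) ∧
      (∀ t : ℝ, γ t = V.map (U (t / 2))) ∧
      -- the relations between `U` and the modular conjugations
      (∀ (t : ℝ) (x : H),
        (γ t).modularConj x = U (t / 2) (V.modularConj ((U (t / 2))⁻¹ x)) ∧
        (γ t).modularConj x = U t (V.modularConj x) ∧
        U t x = (γ t).modularConj (V.modularConj x)) ∧
      -- uniqueness of `U`
      (∀ W : ℝ → (H ≃ₗᵢ[ℂ] H),
        IsUnitaryOneParameterGroup W →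
        (∀ (t : ℝ) (x : H), V.modularConj (W t (V.modularConj x)) = W (-t) x) →
        (∀ t : ℝ, γ t = V.map (W (t / 2))) → W = U) ∧
      -- the relations with the modular conjugations already determine `U`
      (∀ W : ℝ → (H ≃ₗᵢ[ℂ] H),
        IsUnitaryOneParameterGroup W →
        (∀ (t : ℝ) (x : H), V.modularConj (W t (V.modularConj x)) = W (-t) x) →
        (∀ (t : ℝ) (x : H),
          (γ t).modularConj x = W (t / 2) (V.modularConj ((W (t / 2))⁻¹ x))) → W = U) ∧
      (∀ W : ℝ → (H ≃ₗᵢ[ℂ] H),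
        (∀ (t : ℝ) (x : H), (γ t).modularConj x = W t (V.modularConj x)) → W = U) := by
  have hJJ := fun t => (γ t).modularConj_modularConj
  have hVV := V.modularConj_modularConj
  have hJ : ∀ s t x, (γ (2 * s - t)).modularConj x =
      (γ s).modularConj ((γ t).modularConj ((γ s).modularConj x)) := fun s t x => by
    rw [hγ s t, StandardSubspace.modularConj_reflect]
  let U : ℝ → (H ≃ₗᵢ[ℂ] H) := fun t => V.modularConj.trans (γ t).modularConj
  have hUa : ∀ t x, U t x = (γ t).modularConj (V.modularConj x) := fun _ _ => rfl
  have hUi : ∀ t x, (U t)⁻¹ x = V.modularConj ((γ t).modularConj x) := fun t x => by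
    change (U t).symm x = _
    rw [LinearIsometryEquiv.symm_apply_eq, hUa, hVV, hJJ]
  have hneg : ∀ t x, V.modularConj (U t (V.modularConj x)) = U (-t) x := fun t x => by
    have := hJ 0 t (V.modularConj x)
    rw [mul_zero, zero_sub, h0, hVV] at this
    rw [hUa, hUa, hVV, this]
  have hU : IsUnitaryOneParameterGroup U := by
    refine isUnitaryOneParameterGroup_of_map_two_mul_sub ?_ ?_ fun x => hcont _
    · refine LinearIsometryEquiv.ext fun x => ?_
      rw [hUa, h0, hVV]
      rfl
    · intro s t
      refine LinearIsometryEquiv.ext fun x => ?_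
      change _ = U s ((U t)⁻¹ (U s x))
      rw [hUi, hUa, hUa, hUa, hVV, hJ]
  have hmap : ∀ t, γ t = V.map (U (t / 2)) := fun t => by
    have := hγ (t / 2) 0
    rw [sub_zero, mul_div_cancel₀ t two_ne_zero, h0] at this
    exact this
  have hconj : ∀ W : ℝ → (H ≃ₗᵢ[ℂ] H), (∀ t : ℝ, γ t = V.map (W (t / 2))) → ∀ t x,
      (γ t).modularConj x = W (t / 2) (V.modularConj ((W (t / 2))⁻¹ x)) := fun W hW t x => by
    rw [hW t, StandardSubspace.modularConj_map]
    rfl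
  have huniq : ∀ W : ℝ → (H ≃ₗᵢ[ℂ] H),
      (∀ (t : ℝ) (x : H), (γ t).modularConj x = W t (V.modularConj x)) → W = U :=
    fun W hW => funext fun t => LinearIsometryEquiv.ext fun x => by
      rw [hUa, hW, hVV]
  have huniq' : ∀ W : ℝ → (H ≃ₗᵢ[ℂ] H), IsUnitaryOneParameterGroup W →
      (∀ (t : ℝ) (x : H), V.modularConj (W t (V.modularConj x)) = W (-t) x) →
      (∀ (t : ℝ) (x : H),
        (γ t).modularConj x = W (t / 2) (V.modularConj ((W (t / 2))⁻¹ x))) → W = U := by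
    intro W hW hWn hWc
    refine huniq W fun t x => ?_
    have hW0 : W 0 = 1 := by simpa using hW.map_add 0 0
    have hinv : (W (t / 2))⁻¹ = W (-(t / 2)) := by
      rw [inv_eq_iff_mul_eq_one, ← hW.map_add, add_neg_cancel, hW0]
    have hadd : W t = W (t / 2) * W (t / 2) := by rw [← hW.map_add, add_halves]
    rw [hWc, hinv, ← hWn, hVV, hadd]
    rfl
  exact ⟨U, hU, hneg, hmap, fun t x => ⟨hconj U hmap t x, by rw [hUa, hVV], hUa t x⟩,
    fun W hW hWn hWm => huniq' W hW hWn (hconj W hWm), huniq', huniq⟩
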